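/- **Setting.** Let $n\ge 1$ and $m$ be integers and let $\Lambda(x)=\sum_d\Lambda_dx^d$ and $\mathrm P(x)=\sum_d\mathrm P_dx^d$ be degree distribution polynomials with $\Lambda_0=0$. The ensemble $\mathscr P^{(n)}_{\Lambda,\mathrm P}$ is the set of all bipartite pooling graphs with $n$ labelled left nodes (items) and $m$ labelled right nodes (tests) in which, for every $d$, the fraction of left (right) nodes of degree $d$ is $\Lambda_d$ ($\mathrm P_d$). Graphs are taken in the configuration model: a node of degree $d$ has $d$ labelled sockets, and a graph is a bijection between the left and the right sockets (parallel edges are allowed). Assume that the ensemble is nonempty. Write $\bar{\mathtt l}=\sum_d d\Lambda_d$, so that $n\bar{\mathtt l}$ is the number of edges, $\xi=m/n$, and let $\mathtt l_{\max},\mathtt r_{\max}$ be the maximal left and right degrees. For a defective set $\mathcal I$ of items, a test is positive if it is connected to an item of $\mathcal I$, and negative otherwise. An item is possibly defective (PD) if it is connected to no negative test. DD detection declares an item defective if it is PD and has an edge to a positive test none of whose other edges leads to a PD item. A misdetection is an item of $\mathcal I$ that is not declared defective. For $i,j\ge 0$ let $A^{\mathsf{DD}}_{i+j,j}$ be the average,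 over a graph drawn uniformly at random from the ensemble, of the number of patterns (sets $\mathcal I$) with $i+j$ defective items and exactly $j$ misdetections. **Statement.** For all $i,j\ge0$, $$A^{\mathsf{DD}}_{i+j,j}=\sum_{w,e,l,u,o,b_1}\frac{\operatorname{coeff}\big(g(\mathbf x)^n,\;x_1^wx_2^ex_3^lx_4^ux_5^ox_6^{b_1}\big)\;\operatorname{coeff}\big(f(\mathbf t,\mathbf s)^n,\;t_1^it_2^js_1^ws_2^es_3^ls_4^us_5^os_6^{b_1}\big)}{\dbinom{n\bar{\mathtt l}}{w,\,e,\,l,\,u,\,o,\,b_1,\,n\bar{\mathtt l}-w-e-l-u-o-b_1}},$$ where $$g(\mathbf x)=\prod_{d=1}^{\mathtt r_{\max}}\Big[1+(x_1+x_2+x_4+x_5)^d-(x_2+x_4)^d-d\,x_1x_2^{d-1}-d\,x_5x_2^{d-1}+d\,x_3^{d-1}x_6\Big]^{\xi\mathrm P_d},$$ $$f(\mathbf t,\mathbf s)=\prod_{d=1}^{\mathtt l_{\max}}\Big[t_1\big((s_5+s_6)^d-s_5^d\big)+t_2s_1^d+s_4^d+(1+s_2+s_3)^d-(s_2+s_3)^d\Big]^{\Lambda_d},$$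 so that $g^n$ and $f^n$ are polynomials, with the nonnegative integer exponents $n\xi\mathrm P_d=m\mathrm P_d$ and $n\Lambda_d$. The sum is over all integers $w,e,l,u,o,b_1\ge 0$ with $w+e+l+u+o+b_1\le n\bar{\mathtt l}$ for which there are integers $k,b_2\ge0$ with $i+j+k\le n$, $b_1+b_2\le m$ and $$l\le(n-i-j-k)\,\mathtt l_{\max},\quad w+e+u+o\le b_2\,\mathtt r_{\max},\quad n-i-j-k\le(m-b_1-b_2)\,\mathtt r_{\max},$$ $$b_1+b_2\le(i+j)\,\mathtt l_{\max},\quad i\le b_1\le i\,\mathtt l_{\max}.$$ -/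

import Mathlib

open scoped Polynomial

/-- A pooling graph with `n` left nodes (items) and `m` right nodes (tests), in the
configuration model: every left node `v` has `leftDeg v` sockets, every right node `c` has
`rightDeg c` sockets, and the edges are given by a bijection between left and right sockets. -/
structure PoolingGraph (n m : ℕ) where
  leftDeg : Fin n → ℕ
  rightDeg : Fin m → ℕ
  conn : (Σ v, Fin (leftDeg v)) ≃ (Σ c, Fin (rightDeg c))

namespace PoolingGraph

variable {n m : ℕ} (G : PoolingGraph n m)

/-- The edges of the graph, named by their left sockets. -/
abbrev Edge : Type := Σ v, Fin (G.leftDeg v)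

/-- The left end of an edge. -/
def item (e : G.Edge) : Fin n := e.1

/-- The right end of an edge. -/
def test (e : G.Edge) : Fin m := (G.conn e).1

/-- With defective set `I`, the test `c` is positive: it is connected to an item of `I`. -/
def IsPositive (I : Finset (Fin n)) (c : Fin m) : Prop :=
  ∃ e : G.Edge, G.test e = c ∧ G.item e ∈ I

/-- The item `v` is possibly defective (PD): it is not connected to any negative test. -/
def IsPD (I : Finset (Fin n)) (v : Fin n) : Prop :=
  ∀ e : G.Edge, G.item e = v → G.IsPositive I (G.test e)

/-- The item `v` is declared defective by DD detection: it is PD, and it is attached by an edge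
`e` to a positive test all of whose other edges come from items that are not PD. (Entries of a
test are counted with multiplicity: two parallel edges to `v` are two PD entries.) -/
def IsDD (I : Finset (Fin n)) (v : Fin n) : Prop :=
  G.IsPD I v ∧ ∃ e : G.Edge, G.item e = v ∧ G.IsPositive I (G.test e) ∧
    ∀ e' : G.Edge, G.test e' = G.test e → G.IsPD I (G.item e') → e' = e

open Classical in
/-- The set of items that DD detection declares defective when `I` is the defective set. -/
noncomputable def ddEstimate (I : Finset (Fin n)) : Finset (Fin n) :=
  Finset.univ.filter fun v => G.IsDD I v

/-- The number of patterns (defective sets) with `a` defective items of which exactly `j` are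
misdetected by DD detection. -/
noncomputable def ddPatternCount (a j : ℕ) : ℕ :=
  (Finset.univ.filter fun I : Finset (Fin n) =>
    I.card = a ∧ (I \ G.ddEstimate I).card = j).card

/-- `Λ_d` is the fraction of left nodes of degree `d` and `P_d` the fraction of right nodes of
degree `d`, for every `d`. -/
def HasDegreeDistributions (Λ P : ℚ[X]) : Prop :=
  (∀ d, Λ.coeff d = ((Finset.univ.filter fun v => G.leftDeg v = d).card : ℚ) / n) ∧
  (∀ d, P.coeff d = ((Finset.univ.filter fun c => G.rightDeg c = d).card : ℚ) / m)

theorem HasDegreeDistributions.leftDeg_le {G : PoolingGraph n m} {Λ P : ℚ[X]}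
    (h : G.HasDegreeDistributions Λ P) (v : Fin n) : G.leftDeg v ≤ Λ.natDegree := by
  apply Polynomial.le_natDegree_of_ne_zero
  rw [h.1]
  have hn : (n : ℚ) ≠ 0 := by exact_mod_cast (Fin.pos v).ne'
  have hc : (Finset.univ.filter fun w => G.leftDeg w = G.leftDeg v).card ≠ 0 :=
    Finset.card_ne_zero_of_mem (a := v) (by simp)
  exact div_ne_zero (by exact_mod_cast hc) hn

theorem HasDegreeDistributions.rightDeg_le {G : PoolingGraph n m} {Λ P : ℚ[X]}
    (h : G.HasDegreeDistributions Λ P) (c : Fin m) : G.rightDeg c ≤ P.natDegree := by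
  apply Polynomial.le_natDegree_of_ne_zero
  rw [h.2]
  have hm : (m : ℚ) ≠ 0 := by exact_mod_cast (Fin.pos c).ne'
  have hc : (Finset.univ.filter fun w => G.rightDeg w = G.rightDeg c).card ≠ 0 :=
    Finset.card_ne_zero_of_mem (a := c) (by simp)
  exact div_ne_zero (by exact_mod_cast hc) hm

end PoolingGraph

/-- The irregular ensemble: all pooling graphs with `n` left nodes, `m` right nodes and degree
distributions `Λ`, `P`. -/
abbrev PoolingEnsemble (n m : ℕ) (Λ P : ℚ[X]) : Type :=
  {G : PoolingGraph n m // G.HasDegreeDistributions Λ P}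

instance PoolingEnsemble.finite (n m : ℕ) (Λ P : ℚ[X]) : Finite (PoolingEnsemble n m Λ P) := by
  let B : Type := Σ a : Fin n → Fin (Λ.natDegree + 1), Σ b : Fin m → Fin (P.natDegree + 1),
    ((Σ v, Fin (a v : ℕ)) ≃ (Σ c, Fin (b c : ℕ)))
  let F : B → PoolingGraph n m := fun x => ⟨fun v => x.1 v, fun c => x.2.1 c, x.2.2⟩
  have hfin : (Set.range F).Finite := Set.finite_range F
  refine Set.Finite.subset hfin ?_
  intro G hG
  exact ⟨⟨fun v => ⟨G.leftDeg v, Nat.lt_succ_of_le (PoolingGraph.HasDegreeDistributions.leftDeg_le hG v)⟩,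
    fun c => ⟨G.rightDeg c, Nat.lt_succ_of_le (PoolingGraph.HasDegreeDistributions.rightDeg_le hG c)⟩, G.conn⟩, rfl⟩

noncomputable instance PoolingEnsemble.fintype (n m : ℕ) (Λ P : ℚ[X]) :
    Fintype (PoolingEnsemble n m Λ P) := Fintype.ofFinite _

/-- The average, over a graph drawn uniformly at random from the ensemble, of the number of
patterns with `a` defective items and `j` misdetections under DD detection. -/
noncomputable def avgEnumeratorDD (n m : ℕ) (Λ P : ℚ[X]) (a j : ℕ) : ℚ :=
  (∑ G : PoolingEnsemble n m Λ P, (G.1.ddPatternCount a j : ℚ)) /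
    Fintype.card (PoolingEnsemble n m Λ P)

/-- The total number `n · (∑ d, d Λ_d)` of edges. (It is an integer if the ensemble is
nonempty, so the floor changes nothing.) -/
noncomputable def numEdges (n : ℕ) (Λ : ℚ[X]) : ℕ :=
  ⌊(n : ℚ) * Λ.sum fun d c => (d : ℚ) * c⌋₊

open MvPolynomial in
/-- The `n`-th power of `g(x) = ∏_{d=1}^{r_max} [⋯]^{ξ P_d}`, where `ξ = m / n`. The variables
`x₁, …, x₆` are `X 0, …, X 5`. The exponents `n ξ P_d` are integers if the ensemble is
nonempty, so the floor changes nothing. -/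
noncomputable def gPow (n m : ℕ) (P : ℚ[X]) : MvPolynomial (Fin 6) ℚ :=
  ∏ d ∈ Finset.Icc 1 P.natDegree,
    (1 + (X 0 + X 1 + X 3 + X 4) ^ d - (X 1 + X 3) ^ d
      - (d : MvPolynomial (Fin 6) ℚ) * X 0 * X 1 ^ (d - 1)
      - (d : MvPolynomial (Fin 6) ℚ) * X 4 * X 1 ^ (d - 1)
      + (d : MvPolynomial (Fin 6) ℚ) * X 2 ^ (d - 1) * X 5) ^
        ⌊(n : ℚ) * (((m : ℚ) / n) * P.coeff d)⌋₊

/-- The variables `t₁, t₂`. -/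
noncomputable def tVar (k : Fin 2) : MvPolynomial (Fin 2 ⊕ Fin 6) ℚ := MvPolynomial.X (Sum.inl k)

/-- The variables `s₁, …, s₆` (indexed from `0`). -/
noncomputable def sVar (k : Fin 6) : MvPolynomial (Fin 2 ⊕ Fin 6) ℚ := MvPolynomial.X (Sum.inr k)

/-- The `n`-th power of `f(t, s) = ∏_{d=1}^{l_max} [⋯]^{Λ_d}`. The exponents `n Λ_d` are
integers if the ensemble is nonempty, so the floor changes nothing. -/
noncomputable def fPow (n : ℕ) (Λ : ℚ[X]) : MvPolynomial (Fin 2 ⊕ Fin 6) ℚ :=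
  ∏ d ∈ Finset.Icc 1 Λ.natDegree,
    (tVar 0 * ((sVar 4 + sVar 5) ^ d - sVar 4 ^ d) + tVar 1 * sVar 0 ^ d + sVar 3 ^ d
      + (1 + sVar 1 + sVar 2) ^ d - (sVar 1 + sVar 2) ^ d) ^ ⌊(n : ℚ) * Λ.coeff d⌋₊

/-- The coefficient of `x₁^w x₂^e x₃^l x₄^u x₅^o x₆^b₁` in `g(x)^n`. -/
noncomputable def gCoeff (n m : ℕ) (P : ℚ[X]) (w e l u o b₁ : ℕ) : ℚ :=
  (gPow n m P).coeff (Finsupp.equivFunOnFinite.symm ![w, e, l, u, o, b₁])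

/-- The coefficient of `t₁^i t₂^j s₁^w s₂^e s₃^l s₄^u s₅^o s₆^b₁` in `f(t, s)^n`. -/
noncomputable def fCoeff (n : ℕ) (Λ : ℚ[X]) (i j w e l u o b₁ : ℕ) : ℚ :=
  (fPow n Λ).coeff (Finsupp.equivFunOnFinite.symm (Sum.elim ![i, j] ![w, e, l, u, o, b₁]))

/-- The summation range: the tuples for which there are a number `k` of non-defective PD items
and a number `b₂` of further positive tests satisfying the stated inequalities. The maximal
degrees `l_max`, `r_max` are the degrees of the polynomials `Λ`, `P`. -/
def DDAdmissible (n m : ℕ) (Λ P : ℚ[X]) (i j w e l u o b₁ : ℕ) : Prop :=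
  w + e + l + u + o + b₁ ≤ numEdges n Λ ∧
  ∃ k b₂ : ℕ, i + j + k ≤ n ∧ b₁ + b₂ ≤ m ∧
    l ≤ (n - i - j - k) * Λ.natDegree ∧
    w + e + u + o ≤ b₂ * P.natDegree ∧
    n - i - j - k ≤ (m - b₁ - b₂) * P.natDegree ∧
    b₁ + b₂ ≤ (i + j) * Λ.natDegree ∧
    i ≤ b₁ ∧ b₁ ≤ i * Λ.natDegree

open Classical in
/-- The finite set of all admissible `(w, e, l, u, o, b₁)`; every entry of an admissible tuple
is at most the number of edges. -/
noncomputable def ddRange (n m : ℕ) (Λ P : ℚ[X]) (i j : ℕ) : Finset (Fin 6 → ℕ) :=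
  (Fintype.piFinset fun _ => Finset.range (numEdges n Λ + 1)).filter fun a =>
    DDAdmissible n m Λ P i j (a 0) (a 1) (a 2) (a 3) (a 4) (a 5)

/-- The multinomial coefficient `N! / (w! e! l! u! o! b₁! (N - w - e - l - u - o - b₁)!)`,
used for `w + e + l + u + o + b₁ ≤ N`. -/
def multinomialSeven (N w e l u o b₁ : ℕ) : ℕ :=
  Nat.multinomial Finset.univ ![w, e, l, u, o, b₁, N - w - e - l - u - o - b₁]

/-! The proof is a double count of graphs with consistent local labels. Given a graph and a pattern,
each item has one of four statuses and each edge a label: `some 0` if the item is missed, `some 3`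
if it is hidden, `some 4` or `some 5` if it is detected and the test is not, or is, revealing
(positive with a single PD edge); an edge of a cleared item gets `some 1` or `some 2` by the same
distinction at a positive test, and `none` at a negative one.

The labels obey rules at each node separately (`ItemValid`, `TestValid`). Conversely, any labels
obeying these rules at all nodes are the ones DD detection produces for the pattern of detected and
missed items (`itemStatus_eq`, `edgeLabel_eq`). Hence patterns on a fixed graph correspond to pairs
of valid left and right labellings that agree along the edges (`ddPatternCount_eq`).

Summing valid words at one node gives the brackets of `g` and `f` (`sum_testWords`,
`sum_itemWords`), so coefficients of the powers count valid labellings with given label counts. Two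
labellings with the same counts agree under a product of factorials of bijections
(`card_equiv_of_comp_eq`), which is the number of all bijections divided by the multinomial
coefficient. The inequalities of the summation range hold for every pair that contributes, so the
restriction loses nothing. -/

section WordSums

/-! ### Generating functions of words -/

variable {R L : Type*} [CommRing R] {d : ℕ}

theorem sum_words_forall_mem (y : L → R) (A : Finset L) (S : Finset (Fin d → L))
    (hS : ∀ r, r ∈ S ↔ ∀ k, r k ∈ A) :
    ∑ r ∈ S, ∏ k, y (r k) = (∑ l ∈ A, y l) ^ d := by
  have h : S = Fintype.piFinset fun _ => A := by ext r; simp [hS]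
  rw [h, ← Finset.prod_univ_sum (fun _ : Fin d => A) (fun _ l => y l)]
  simp

theorem sum_words_exists_mem [DecidableEq L] (y : L → R) (A B : Finset L) (S : Finset (Fin d → L))
    (hS : ∀ r, r ∈ S ↔ (∀ k, r k ∈ A) ∧ ∃ k, r k ∈ B) :
    ∑ r ∈ S, ∏ k, y (r k) = (∑ l ∈ A, y l) ^ d - (∑ l ∈ A \ B, y l) ^ d := by
  classical
  have hsub : Fintype.piFinset (fun _ : Fin d => A \ B) ⊆ Fintype.piFinset (fun _ : Fin d => A) :=
    Fintype.piFinset_subset _ _ fun _ => Finset.sdiff_subset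
  have h : S = Fintype.piFinset (fun _ : Fin d => A) \ Fintype.piFinset (fun _ : Fin d => A \ B) := by
    ext r
    simp only [hS, Finset.mem_sdiff, Fintype.mem_piFinset, not_forall]
    grind
  rw [h, eq_sub_iff_add_eq, ← sum_words_forall_mem y (A \ B) _ (fun r => Fintype.mem_piFinset),
    Finset.sum_sdiff hsub, ← sum_words_forall_mem y A _ (fun r => Fintype.mem_piFinset)]

/-- Since `c ∉ Z`, the exceptional position and its letter are determined by the word. For `d = 0`
both sides vanish, so the truncated exponent `d - 1` is harmless. -/
theorem sum_words_single (y : L → R) (Z : Finset L) (c : L) (hc : c ∉ Z) (S : Finset (Fin d → L))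
    (hS : ∀ r, r ∈ S ↔ ∃ k, r k ∈ Z ∧ ∀ k', k' ≠ k → r k' = c) :
    ∑ r ∈ S, ∏ k, y (r k) = d * (∑ z ∈ Z, y z) * y c ^ (d - 1) := by
  classical
  have h : ∑ x ∈ (Finset.univ : Finset (Fin d)) ×ˢ Z, y x.2 * y c ^ (d - 1) =
      ∑ r ∈ S, ∏ k, y (r k) := by
    refine Finset.sum_bij (fun x _ => Function.update (fun _ => c) x.1 x.2) ?_ ?_ ?_ ?_
    · rintro ⟨k, z⟩ hz
      rw [hS]
      exact ⟨k, by simpa using hz, fun k' hk' => by simp [hk']⟩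
    · rintro ⟨k, z⟩ hz ⟨k', z'⟩ hz' heq
      simp only [Finset.mem_product, Finset.mem_univ, true_and] at hz hz'
      have h1 := congrFun heq k
      have h2 : k = k' := by
        by_contra hk
        rw [Function.update_self, Function.update_of_ne hk] at h1
        exact hc (h1 ▸ hz)
      subst h2
      simpa using h1
    · intro r hr
      obtain ⟨k, hk, hk'⟩ := (hS r).1 hr
      refine ⟨(k, r k), by simpa using hk, ?_⟩
      ext k'
      by_cases hkk : k' = k
      · subst hkk; simp
      · simp [hkk, hk' k' hkk]
    · rintro ⟨k, z⟩ hz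
      rw [← Finset.mul_prod_erase _ _ (Finset.mem_univ k), Function.update_self]
      congr 1
      rw [Finset.prod_congr rfl (g := fun _ => y c)]
      · simp
      · intro k' hk'
        rw [Function.update_of_ne (Finset.ne_of_mem_erase hk')]
  rw [← h, Finset.sum_product]
  simp [Finset.mul_sum, Finset.sum_mul, mul_assoc]

end WordSums

/-- Coefficients of a product of sums of monomials count the choices of one monomial from each
factor with the right total exponent. -/
theorem coeff_prod_sum_monomial {ι σ : Type*} [Fintype ι] [DecidableEq ι] [DecidableEq σ]
    {Ω : ι → Type*} (S : ∀ v, Finset (Ω v)) (E : ∀ v, Ω v → σ →₀ ℕ) (μ : σ →₀ ℕ) :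
    (∏ v, ∑ p ∈ S v, MvPolynomial.monomial (E v p) (1 : ℚ)).coeff μ =
      (((Fintype.piFinset S).filter fun p => ∑ v, E v (p v) = μ).card : ℚ) := by
  rw [Finset.prod_univ_sum, MvPolynomial.coeff_sum, Finset.card_filter, Nat.cast_sum]
  refine Finset.sum_congr rfl fun p _ => ?_
  rw [← MvPolynomial.monomial_sum_one, MvPolynomial.coeff_monomial]
  simp

/-- Equivalences carrying one colouring to another. -/
theorem card_equiv_of_comp_eq {X Y L : Type*} [Fintype X] [Fintype Y] [Fintype L] [DecidableEq X]
    [DecidableEq Y] [DecidableEq L] (f : X → L) (g : Y → L) :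
    (Finset.univ.filter fun π : X ≃ Y => ∀ x, g (π x) = f x).card =
      if ∀ l, (Finset.univ.filter fun x => f x = l).card =
        (Finset.univ.filter fun y => g y = l).card
      then ∏ l, ((Finset.univ.filter fun x => f x = l).card).factorial else 0 := by
  split_ifs with h
  · have h1 : ∀ l, Nonempty ({x // f x = l} ≃ {y // g y = l}) := fun l => by
      rw [← Fintype.card_eq, Fintype.card_subtype, Fintype.card_subtype, h]
    -- Composition with the inverse of one compatible bijection turns the others into the
    -- permutations of `X` that preserve `f`.
    let σ : X ≃ Y := Equiv.ofFiberEquiv fun l => (h1 l).some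
    have hσ : ∀ x, g (σ x) = f x := Equiv.ofFiberEquiv_map _
    have h2 := DomMulAct.stabilizer_card f
    simp only [Fintype.card_subtype] at h2
    rw [← h2]
    refine Finset.card_bij (fun π _ => π.trans σ.symm) ?_ ?_ ?_
    · intro π hπ
      simp only [Finset.mem_filter, Finset.mem_univ, true_and] at hπ ⊢
      ext x
      simp [← hσ, hπ]
    · intro π _ π' _ heq
      ext x
      simpa using Equiv.congr_fun heq x
    · intro τ hτ
      refine ⟨τ.trans σ, ?_, by ext; simp⟩
      simp only [Finset.mem_filter, Finset.mem_univ, true_and] at hτ ⊢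
      intro x
      simpa [hσ] using congrFun hτ x
  · rw [Finset.card_eq_zero, Finset.filter_eq_empty_iff]
    intro π _ hπ
    refine h fun l => Finset.card_bij (fun x _ => π x) ?_ (by simp) ?_
    · intro x hx
      simpa [hπ] using hx
    · intro y hy
      exact ⟨π.symm y, by simpa [← hπ] using hy, by simp⟩

/-! ### Statuses, labels and the local rules -/

/-- The status of an item: a detected defective, a misdetected defective, a nondefective PD item,
or an item that is not PD. -/
inductive ItemStatus
  | detected | missed | hidden | cleared
  deriving DecidableEq

instance : Fintype ItemStatus :=
  ⟨{.detected, .missed, .hidden, .cleared}, by rintro (_ | _ | _ | _) <;> decide⟩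

/-- The label of an edge: `some k` is recorded by the variable `x_{k+1}` (or `s_{k+1}`), and
`none` is the label of the edges into negative tests. -/
abbrev EdgeLabel : Type := Option (Fin 6)

/-- The words that can label the edges of an item of given status. -/
def ItemValid {ι : Type} : ItemStatus → (ι → EdgeLabel) → Prop
  | .detected, r => (∀ k, r k = some 4 ∨ r k = some 5) ∧ ∃ k, r k = some 5
  | .missed, r => ∀ k, r k = some 0
  | .hidden, r => ∀ k, r k = some 3
  | .cleared, r => (∀ k, r k = none ∨ r k = some 1 ∨ r k = some 2) ∧ ∃ k, r k = none

/-- The words that can label the edges of a negative test. -/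
def NegativeWord {ι : Type} (r : ι → EdgeLabel) : Prop := ∀ k, r k = none

/-- The words that can label the edges of a test at which a defective item is detected. -/
def RevealingWord {ι : Type} (r : ι → EdgeLabel) : Prop :=
  ∃ k, r k = some 5 ∧ ∀ k', k' ≠ k → r k' = some 2

/-- The words that can label the edges of a positive test at which no item is detected. -/
def PositiveWord {ι : Type} (r : ι → EdgeLabel) : Prop :=
  ((∀ k, r k = some 0 ∨ r k = some 1 ∨ r k = some 3 ∨ r k = some 4) ∧
    ∃ k, r k = some 0 ∨ r k = some 4) ∧
  ¬∃ k, (r k = some 0 ∨ r k = some 4) ∧ ∀ k', k' ≠ k → r k' = some 1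

/-- The words that can label the edges of a test. -/
def TestValid {ι : Type} (r : ι → EdgeLabel) : Prop :=
  NegativeWord r ∨ RevealingWord r ∨ PositiveWord r

/-- The rules at a test ignore the order of its sockets, so they can be checked on its edges
instead. -/
theorem testValid_comp_equiv {ι κ : Type} (s : ι ≃ κ) (r : κ → EdgeLabel) :
    TestValid (fun k => r (s k)) ↔ TestValid r := by
  simp only [TestValid, NegativeWord, RevealingWord, PositiveWord, s.forall_congr_left,
    s.exists_congr_left, s.apply_symm_apply, ne_eq, s.symm.injective.eq_iff]

/-! ### Labels produced by DD detection obey the rules -/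

namespace PoolingGraph

variable {n m : ℕ} (G : PoolingGraph n m) (I : Finset (Fin n))

/-- The test `c` is positive and has exactly one edge to a PD item. -/
def IsRevealing (c : Fin m) : Prop :=
  G.IsPositive I c ∧ ∃ e, G.test e = c ∧ ∀ e', G.test e' = c → G.IsPD I (G.item e') → e' = e

open Classical in
/-- The status of an item under DD detection. -/
noncomputable def itemStatus (v : Fin n) : ItemStatus :=
  if v ∈ I then if G.IsDD I v then .detected else .missed
  else if G.IsPD I v then .hidden else .cleared

open Classical in
/-- The label of an edge under DD detection. -/
noncomputable def edgeLabel (e : G.Edge) : EdgeLabel :=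
  match G.itemStatus I (G.item e) with
  | .detected => if G.IsRevealing I (G.test e) then some 5 else some 4
  | .missed => some 0
  | .hidden => some 3
  | .cleared =>
    if G.IsPositive I (G.test e) then if G.IsRevealing I (G.test e) then some 2 else some 1
    else none

variable {G I}

theorem isPD_of_mem {v : Fin n} (hv : v ∈ I) : G.IsPD I v := fun e he => ⟨e, rfl, he ▸ hv⟩

theorem itemStatus_eq_detected {v : Fin n} :
    G.itemStatus I v = .detected ↔ v ∈ I ∧ G.IsDD I v := by
  unfold itemStatus; split_ifs <;> simp_all

theorem itemStatus_eq_missed {v : Fin n} :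
    G.itemStatus I v = .missed ↔ v ∈ I ∧ ¬G.IsDD I v := by
  unfold itemStatus; split_ifs <;> simp_all

theorem itemStatus_eq_hidden {v : Fin n} :
    G.itemStatus I v = .hidden ↔ v ∉ I ∧ G.IsPD I v := by
  unfold itemStatus; split_ifs <;> simp_all

theorem itemStatus_eq_cleared {v : Fin n} :
    G.itemStatus I v = .cleared ↔ ¬G.IsPD I v := by
  have := @isPD_of_mem n m G I v
  unfold itemStatus; split_ifs <;> simp_all

/-- Defective items are PD, so `e` must itself be the single PD edge of the test. -/
theorem isDD_of_isRevealing {e : G.Edge} (he : G.item e ∈ I) (hr : G.IsRevealing I (G.test e)) :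
    G.IsDD I (G.item e) := by
  obtain ⟨hp, e₀, h₀, h⟩ := hr
  have := h e rfl (isPD_of_mem he)
  subst this
  exact ⟨isPD_of_mem he, e, rfl, hp, h⟩

/-- The edges of a test, named by its sockets. -/
def socketEquiv (G : PoolingGraph n m) (c : Fin m) :
    Fin (G.rightDeg c) ≃ {e : G.Edge // G.test e = c} where
  toFun k := ⟨G.conn.symm ⟨c, k⟩, by simp [test]⟩
  invFun e := Fin.cast (congrArg G.rightDeg e.2) (G.conn e.1).2
  left_inv k := by
    have h : ∀ y : Σ c, Fin (G.rightDeg c), y = ⟨c, k⟩ → (y.2 : ℕ) = k := by rintro _ rfl; rfl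
    exact Fin.ext (h _ (G.conn.apply_symm_apply ⟨c, k⟩))
  right_inv := by
    rintro ⟨e, rfl⟩
    exact Subtype.ext (G.conn.symm_apply_apply e)

theorem itemValid_itemStatus (v : Fin n) :
    ItemValid (G.itemStatus I v) fun k : Fin (G.leftDeg v) => G.edgeLabel I ⟨v, k⟩ := by
  have key : ∀ k, G.item (⟨v, k⟩ : G.Edge) = v := fun _ => rfl
  cases h : G.itemStatus I v
  · simp only [ItemValid, edgeLabel, key, h]
    refine ⟨fun k => by split_ifs <;> simp, ?_⟩
    obtain ⟨hv, hpd, e, rfl, hp, he⟩ := itemStatus_eq_detected.1 h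
    exact ⟨e.2, if_pos ⟨hp, e, rfl, he⟩⟩
  · simp [ItemValid, edgeLabel, key, h]
  · simp [ItemValid, edgeLabel, key, h]
  · simp only [ItemValid, edgeLabel, key, h]
    refine ⟨fun k => by split_ifs <;> simp, ?_⟩
    have := itemStatus_eq_cleared.1 h
    simp only [IsPD, not_forall] at this
    obtain ⟨e, rfl, hp⟩ := this
    exact ⟨e.2, if_neg hp⟩

theorem testValid_edgeLabel (c : Fin m) :
    TestValid fun e : {e : G.Edge // G.test e = c} => G.edgeLabel I e := by
  by_cases hp : G.IsPositive I c
  · by_cases hr : G.IsRevealing I c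
    · refine Or.inr (Or.inl ?_)
      obtain ⟨e, he, heI⟩ := hp
      have hr' := hr
      obtain ⟨-, e₀, h₀, h⟩ := hr'
      obtain rfl := h e he (isPD_of_mem heI)
      have hd : G.itemStatus I (G.item e) = .detected :=
        itemStatus_eq_detected.2 ⟨heI, isDD_of_isRevealing heI (he ▸ hr)⟩
      refine ⟨⟨e, he⟩, ?_, ?_⟩
      · simp [edgeLabel, hd, he, hr]
      · rintro ⟨e', he'⟩ hne
        have hc : G.itemStatus I (G.item e') = .cleared :=
          itemStatus_eq_cleared.2 fun hpd => hne (Subtype.ext (h e' he' hpd))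
        simp [edgeLabel, hc, he', hr, hr.1]
    · refine Or.inr (Or.inr ⟨⟨?_, ?_⟩, ?_⟩)
      · rintro ⟨e, he⟩
        simp only [edgeLabel, he, hp, hr, if_true, if_false]
        split <;> simp
      · obtain ⟨e, he, heI⟩ := hp
        refine ⟨⟨e, he⟩, ?_⟩
        by_cases hd : G.IsDD I (G.item e)
        · simp [edgeLabel, itemStatus_eq_detected.2 ⟨heI, hd⟩, he, hr]
        · simp [edgeLabel, itemStatus_eq_missed.2 ⟨heI, hd⟩]
      -- If all other edges had label `some 1`, their items would be cleared and the test would be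
      -- revealing.
      · rintro ⟨⟨e, he⟩, -, h⟩
        refine hr ⟨hp, e, he, fun e' he' hpd => ?_⟩
        by_contra hne
        have h1 := h ⟨e', he'⟩ (by simpa using hne)
        have h2 : G.itemStatus I (G.item e') ≠ .cleared := fun hc =>
          itemStatus_eq_cleared.1 hc hpd
        simp only [edgeLabel, he', hr, if_false] at h1
        split at h1 <;> simp_all
  · refine Or.inl ?_
    rintro ⟨e, he⟩
    have hc : G.itemStatus I (G.item e) = .cleared :=
      itemStatus_eq_cleared.2 fun hpd => hp (he ▸ hpd e rfl)
    simp [edgeLabel, hc, he, hp]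

/-! ### Valid labels determine statuses and edge labels -/

section Reconstruction

variable {τ : Fin n → ItemStatus} {lam : G.Edge → EdgeLabel}
  (hI : ∀ v, v ∈ I ↔ τ v = .detected ∨ τ v = .missed)
  (hitem : ∀ v, ItemValid (τ v) fun k : Fin (G.leftDeg v) => lam ⟨v, k⟩)
  (htest : ∀ c, TestValid fun e : {e : G.Edge // G.test e = c} => lam e)

include hitem in
theorem status_cases_of_label (e : G.Edge) :
    (τ (G.item e) = .detected ∧ (lam e = some 4 ∨ lam e = some 5)) ∨
    (τ (G.item e) = .missed ∧ lam e = some 0) ∨ (τ (G.item e) = .hidden ∧ lam e = some 3) ∨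
    (τ (G.item e) = .cleared ∧ (lam e = none ∨ lam e = some 1 ∨ lam e = some 2)) := by
  have h := hitem (G.item e)
  cases ht : τ (G.item e) <;> simp only [ht, ItemValid] at h
  · exact Or.inl ⟨rfl, h.1 e.2⟩
  · exact Or.inr (Or.inl ⟨rfl, h e.2⟩)
  · exact Or.inr (Or.inr (Or.inl ⟨rfl, h e.2⟩))
  · exact Or.inr (Or.inr (Or.inr ⟨rfl, h.1 e.2⟩))

include hI hitem htest

/-- A negative word contains only `none`; the other two kinds never contain `none` and always
contain a defective letter (`some 0`, `some 4` or `some 5`). -/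
theorem isPositive_test_iff (e : G.Edge) : G.IsPositive I (G.test e) ↔ lam e ≠ none := by
  have hc := status_cases_of_label hitem
  constructor
  · rintro ⟨e', he', hI'⟩ hn
    rw [hI] at hI'
    have := hc e'
    rcases htest (G.test e) with h | ⟨k, h1, h2⟩ | ⟨⟨h1, -⟩, -⟩
    · have := h ⟨e', he'⟩
      simp_all
    · by_cases hk : (⟨e, rfl⟩ : {e' : G.Edge // G.test e' = G.test e}) = k
      · subst hk; simp_all
      · simpa [hn] using h2 _ hk
    · simpa [hn] using h1 ⟨e, rfl⟩
  · intro hn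
    rcases htest (G.test e) with h | ⟨⟨e', he'⟩, h1, -⟩ | ⟨⟨-, ⟨e', he'⟩, h1⟩, -⟩
    · exact absurd (h ⟨e, rfl⟩) hn
    · refine ⟨e', he', (hI _).2 ?_⟩
      have := hc e'
      simp_all
    · refine ⟨e', he', (hI _).2 ?_⟩
      have := hc e'
      rcases h1 with h1 | h1 <;> simp_all

/-- Words of cleared items must contain `none`, and no other item words may. -/
theorem isPD_iff (v : Fin n) : G.IsPD I v ↔ τ v ≠ .cleared := by
  have hp := isPositive_test_iff hI hitem htest
  constructor
  · intro h hv
    have h1 := hitem v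
    rw [hv] at h1
    obtain ⟨-, k, hk⟩ := h1
    exact (hp ⟨v, k⟩).1 (h ⟨v, k⟩ rfl) hk
  · rintro hv e rfl
    rw [hp]
    have := status_cases_of_label hitem e
    intro hn
    simp_all

/-- The letters `some 5` and `some 2` make up the revealing words and occur in no others. The point
is that a positive word never belongs to a revealing test. -/
theorem isRevealing_test_iff (e : G.Edge) :
    G.IsRevealing I (G.test e) ↔ lam e = some 5 ∨ lam e = some 2 := by
  have hp := isPositive_test_iff hI hitem htest
  have hpd := isPD_iff hI hitem htest
  have hc := status_cases_of_label hitem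
  rcases htest (G.test e) with h | ⟨⟨e₀, h₀⟩, h1, h2⟩ | ⟨⟨h1, ⟨e₀, h₀⟩, h2⟩, h3⟩
  · have h1 : lam e = none := h ⟨e, rfl⟩
    have h2 : ¬G.IsPositive I (G.test e) := by rw [hp]; simpa using h1
    simp [IsRevealing, h1, h2]
  · have h3 : lam e = some 5 ∨ lam e = some 2 := by
      by_cases hk : (⟨e, rfl⟩ : {e' : G.Edge // G.test e' = G.test e}) = ⟨e₀, h₀⟩
      · left; rw [Subtype.mk.injEq] at hk; subst hk; exact h1
      · right; exact h2 _ hk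
    refine iff_of_true ⟨(hp e).2 (by rcases h3 with h | h <;> simp [h]), e₀, h₀, ?_⟩ h3
    intro e' he' hpd'
    by_contra hne
    have h4 : lam e' = some 2 := h2 ⟨e', he'⟩ (by simpa using hne)
    have := hc e'
    rw [hpd] at hpd'
    simp_all
  · have h4 : ¬(lam e = some 5 ∨ lam e = some 2) := by
      have h5 : lam e = some 0 ∨ lam e = some 1 ∨ lam e = some 3 ∨ lam e = some 4 := h1 ⟨e, rfl⟩
      rcases h5 with h | h | h | h <;> simp [h]
    refine iff_of_false ?_ h4
    rintro ⟨-, e₁, h₁, h5⟩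
    have h6 : e₀ = e₁ := h5 e₀ h₀ ((hpd _).2 (by
      have := hc e₀
      rcases h2 with h | h <;> simp_all))
    subst h6
    -- With `e₀` as the only PD edge, all other edges come from cleared items, and the only cleared
    -- letter of a positive word is `some 1`: the excluded case.
    refine h3 ⟨⟨e₀, h₀⟩, h2, ?_⟩
    rintro ⟨e', he'⟩ hne
    have h7 : ¬τ (G.item e') ≠ .cleared := fun hh =>
      hne (Subtype.ext (h5 e' he' ((hpd _).2 hh)))
    have h8 := hc e'
    have h9 := h1 ⟨e', he'⟩
    simp only [ne_eq, not_not] at h7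
    clear h3 hc h1 h5
    simp only [h7] at h8
    rcases h9 with h9 | h9 | h9 | h9 <;> simp_all

/-- A detected word has a `some 5`, hence an edge to a revealing test; a missed word has only `some
0`, which never occurs at such a test. -/
theorem itemStatus_eq : G.itemStatus I = τ := by
  have hpd := isPD_iff hI hitem htest
  have hr := isRevealing_test_iff hI hitem htest
  have hp := isPositive_test_iff hI hitem htest
  funext v
  have hv := hitem v
  cases h : τ v
  · rw [h] at hv
    obtain ⟨-, k, hk⟩ := hv
    have hvI : v ∈ I := (hI v).2 (Or.inl h)
    exact itemStatus_eq_detected.2 ⟨hvI,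
      isDD_of_isRevealing (e := ⟨v, k⟩) hvI ((hr _).2 (Or.inl hk))⟩
  · rw [h] at hv
    refine itemStatus_eq_missed.2 ⟨(hI v).2 (Or.inr h), ?_⟩
    rintro ⟨-, e, rfl, hpos, he⟩
    have h1 : lam e = some 0 := hv e.2
    have h2 := (hr e).1 ⟨hpos, e, rfl, he⟩
    simp [h1] at h2
  · exact itemStatus_eq_hidden.2 ⟨by simp [hI, h], by simp [hpd, h]⟩
  · exact itemStatus_eq_cleared.2 (by simp [hpd, h])

theorem edgeLabel_eq : G.edgeLabel I = lam := by
  have hs := itemStatus_eq hI hitem htest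
  have hr := isRevealing_test_iff hI hitem htest
  have hp := isPositive_test_iff hI hitem htest
  have hc := status_cases_of_label hitem
  funext e
  rcases hc e with ⟨h1, h2 | h2⟩ | ⟨h1, h2⟩ | ⟨h1, h2⟩ | ⟨h1, h2 | h2 | h2⟩ <;>
    simp [edgeLabel, hs, h1, hr, hp, h2]

end Reconstruction

end PoolingGraph

/-! ### Patterns of a fixed graph as pairs of labellings -/

open Classical in
/-- The statuses of an item of degree `d` with the words that can label its edges. -/
noncomputable def itemWords (d : ℕ) : Finset (ItemStatus × (Fin d → EdgeLabel)) :=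
  Finset.univ.filter fun p => ItemValid p.1 p.2

open Classical in
/-- The words that can label the edges of a test of degree `d`. -/
noncomputable def testWords (d : ℕ) : Finset (Fin d → EdgeLabel) :=
  Finset.univ.filter fun r => TestValid r

theorem mem_itemWords {d : ℕ} {p : ItemStatus × (Fin d → EdgeLabel)} :
    p ∈ itemWords d ↔ ItemValid p.1 p.2 := by
  simp [itemWords]

theorem mem_testWords {d : ℕ} {r : Fin d → EdgeLabel} : r ∈ testWords d ↔ TestValid r := by
  simp [testWords]

/-- A status for every item and a label for every left socket. -/
abbrev ItemLabelling {n : ℕ} (a : Fin n → ℕ) : Type :=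
  ∀ v, ItemStatus × (Fin (a v) → EdgeLabel)

/-- A label for every right socket. -/
abbrev TestLabelling {m : ℕ} (b : Fin m → ℕ) : Type := ∀ c, Fin (b c) → EdgeLabel

/-- The number of items with given status. -/
def statusCount {n : ℕ} {a : Fin n → ℕ} (p : ItemLabelling a) (s : ItemStatus) : ℕ :=
  (Finset.univ.filter fun v => (p v).1 = s).card

/-- The number of left sockets with given label. -/
def itemLabelCount {n : ℕ} {a : Fin n → ℕ} (p : ItemLabelling a) (l : EdgeLabel) : ℕ :=
  (Finset.univ.filter fun e : Σ v, Fin (a v) => (p e.1).2 e.2 = l).card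

/-- The number of right sockets with given label. -/
def testLabelCount {m : ℕ} {b : Fin m → ℕ} (q : TestLabelling b) (l : EdgeLabel) : ℕ :=
  (Finset.univ.filter fun e : Σ c, Fin (b c) => q e.1 e.2 = l).card

/-- The item labellings in which every item is validly labelled, with `i` detected and `j`
misdetected items. -/
noncomputable def itemLabellings {n : ℕ} (a : Fin n → ℕ) (i j : ℕ) : Finset (ItemLabelling a) :=
  (Fintype.piFinset fun v => itemWords (a v)).filter fun p =>
    statusCount p .detected = i ∧ statusCount p .missed = j

/-- The test labellings in which every test is validly labelled. -/
noncomputable def testLabellings {m : ℕ} (b : Fin m → ℕ) : Finset (TestLabelling b) :=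
  Fintype.piFinset fun c => testWords (b c)

theorem mem_itemLabellings {n : ℕ} {a : Fin n → ℕ} {i j : ℕ} {p : ItemLabelling a} :
    p ∈ itemLabellings a i j ↔ (∀ v, ItemValid (p v).1 (p v).2) ∧
      statusCount p .detected = i ∧ statusCount p .missed = j := by
  rw [itemLabellings, Finset.mem_filter, Fintype.mem_piFinset]
  simp only [mem_itemWords]

theorem mem_testLabellings {m : ℕ} {b : Fin m → ℕ} {q : TestLabelling b} :
    q ∈ testLabellings b ↔ ∀ c, TestValid (q c) := by
  rw [testLabellings, Fintype.mem_piFinset]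
  simp only [mem_testWords]

/-- For a fixed graph, the patterns correspond to the pairs of valid labellings of the left and of
the right sockets that agree along the edges. -/
theorem PoolingGraph.ddPatternCount_eq {n m : ℕ} (G : PoolingGraph n m) (i j : ℕ) :
    G.ddPatternCount (i + j) j =
      ((itemLabellings G.leftDeg i j ×ˢ testLabellings G.rightDeg).filter fun x =>
        ∀ e, x.2 (G.conn e).1 (G.conn e).2 = (x.1 e.1).2 e.2).card := by
  classical
  have hmem : ∀ I v, v ∈ I ↔ G.itemStatus I v = .detected ∨ G.itemStatus I v = .missed := by
    intro I v
    rw [itemStatus_eq_detected, itemStatus_eq_missed]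
    tauto
  have hmissed : ∀ I, (Finset.univ.filter fun v => G.itemStatus I v = .missed) =
      I \ G.ddEstimate I := by
    intro I
    ext v
    simp [itemStatus_eq_missed, ddEstimate]
  have hdet : ∀ I, (Finset.univ.filter fun v => G.itemStatus I v = .detected).card +
      (Finset.univ.filter fun v => G.itemStatus I v = .missed).card = I.card := by
    intro I
    rw [← Finset.card_union_of_disjoint, ← Finset.filter_or]
    · congr 1
      ext v
      simp [← hmem]
    · rw [Finset.disjoint_filter]
      intro v _ h
      simp [h]
  unfold ddPatternCount
  refine Finset.card_bij (fun I _ => (fun v => (G.itemStatus I v, fun k => G.edgeLabel I ⟨v, k⟩),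
    fun c k => G.edgeLabel I (G.conn.symm ⟨c, k⟩))) ?_ ?_ ?_
  · intro I hI
    simp only [Finset.mem_filter, Finset.mem_univ, true_and] at hI
    simp only [Finset.mem_filter, Finset.mem_product, mem_itemLabellings,
      mem_testLabellings, statusCount]
    refine ⟨⟨⟨fun v => itemValid_itemStatus v, ?_, ?_⟩, fun c => ?_⟩, fun e => ?_⟩
    · have h1 := hdet I
      rw [hmissed] at h1
      omega
    · rw [hmissed]; exact hI.2
    · exact (testValid_comp_equiv (G.socketEquiv c) _).2 (testValid_edgeLabel c)
    · simp
  · intro I _ I' _ heq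
    -- The statuses alone determine the pattern.
    have h1 := congrArg Prod.fst heq
    have h2 : G.itemStatus I = G.itemStatus I' := funext fun v => congrArg Prod.fst (congrFun h1 v)
    ext v
    rw [hmem, hmem, h2]
  · rintro ⟨p, q⟩ h
    simp only [Finset.mem_filter, Finset.mem_product, mem_itemLabellings,
      mem_testLabellings, statusCount] at h
    obtain ⟨⟨⟨hp, hi, hj⟩, hq⟩, hc⟩ := h
    let I : Finset (Fin n) := Finset.univ.filter fun v => (p v).1 = .detected ∨ (p v).1 = .missed
    let lam : G.Edge → EdgeLabel := fun e => (p e.1).2 e.2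
    have hI : ∀ v, v ∈ I ↔ (p v).1 = .detected ∨ (p v).1 = .missed := by simp [I]
    have hq' : ∀ c k, lam (G.conn.symm ⟨c, k⟩) = q c k := by
      intro c k
      have := hc (G.conn.symm ⟨c, k⟩)
      rw [G.conn.apply_symm_apply] at this
      exact this.symm
    have htest : ∀ c, TestValid fun e : {e : G.Edge // G.test e = c} => lam e := by
      intro c
      rw [← testValid_comp_equiv (G.socketEquiv c)]
      convert hq c using 2 with k
      exact hq' c k
    have hs := itemStatus_eq (lam := lam) hI hp htest
    have hl := edgeLabel_eq (lam := lam) hI hp htest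
    refine ⟨I, ?_, ?_⟩
    · simp only [Finset.mem_filter, Finset.mem_univ, true_and]
      rw [← hmissed, ← hdet, hs]
      simp only [hi, hj, and_self]
    · rw [Prod.mk.injEq]
      refine ⟨funext fun v => Prod.ext (congrFun hs v) ?_, ?_⟩
      · rw [hl]
      · funext c k
        rw [hl]
        exact hq' c k

/-! ### Local words give the factors of `g` and `f` -/

/-- The exponent of the monomial of a label. -/
noncomputable def labelExponent (l : EdgeLabel) : Fin 6 →₀ ℕ := l.elim 0 fun k => Finsupp.single k 1

/-- The exponent of the monomial of a label in the variables `s`. -/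
noncomputable def itemLabelExponent (l : EdgeLabel) : Fin 2 ⊕ Fin 6 →₀ ℕ :=
  l.elim 0 fun k => Finsupp.single (Sum.inr k) 1

/-- The exponent of the monomial of a status in the variables `t`. -/
noncomputable def statusExponent : ItemStatus → (Fin 2 ⊕ Fin 6 →₀ ℕ)
  | .detected => Finsupp.single (Sum.inl 0) 1
  | .missed => Finsupp.single (Sum.inl 1) 1
  | _ => 0

open MvPolynomial in
theorem sum_testWords (d : ℕ) :
    ∑ r ∈ testWords d, monomial (∑ k, labelExponent (r k)) (1 : ℚ) =
      (1 + (X 0 + X 1 + X 3 + X 4) ^ d - (X 1 + X 3) ^ d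
      - (d : MvPolynomial (Fin 6) ℚ) * X 0 * X 1 ^ (d - 1)
      - (d : MvPolynomial (Fin 6) ℚ) * X 4 * X 1 ^ (d - 1)
      + (d : MvPolynomial (Fin 6) ℚ) * X 2 ^ (d - 1) * X 5) := by
  classical
  let y : EdgeLabel → MvPolynomial (Fin 6) ℚ := fun l => monomial (labelExponent l) 1
  have hy : ∀ k, y (some k) = X k := fun k => rfl
  have hy0 : y none = 1 := rfl
  simp only [monomial_sum_one]
  change ∑ r ∈ testWords d, ∏ k, y (r k) = _
  let S₁ : Finset (Fin d → EdgeLabel) := Finset.univ.filter NegativeWord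
  let S₂ : Finset (Fin d → EdgeLabel) := Finset.univ.filter RevealingWord
  let A : Finset EdgeLabel := {some 0, some 1, some 3, some 4}
  let Z : Finset EdgeLabel := {some 0, some 4}
  let S₃ : Finset (Fin d → EdgeLabel) := Finset.univ.filter fun r => (∀ k, r k ∈ A) ∧ ∃ k, r k ∈ Z
  let S₄ : Finset (Fin d → EdgeLabel) := Finset.univ.filter fun r =>
    ∃ k, r k ∈ Z ∧ ∀ k', k' ≠ k → r k' = some 1
  have h43 : S₄ ⊆ S₃ := by
    intro r hr
    simp only [S₄, S₃, Finset.mem_filter, Finset.mem_univ, true_and] at hr ⊢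
    obtain ⟨k, hk, hk'⟩ := hr
    refine ⟨fun k' => ?_, k, hk⟩
    by_cases h : k' = k
    · subst h
      simp only [Z, A, Finset.mem_insert, Finset.mem_singleton] at hk ⊢
      tauto
    · simp [hk' k' h, A]
  -- `S₃` collects the words with a defective letter but no revealing label; `S₄` holds those among
  -- them whose defective letter is the only PD one, to be subtracted.
  have hS : testWords d = S₁ ∪ (S₂ ∪ S₃ \ S₄) := by
    ext r
    simp [mem_testWords, TestValid, S₁, S₂, S₃, S₄, A, Z, PositiveWord]
  have h23 : Disjoint S₂ (S₃ \ S₄) := by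
    rw [Finset.disjoint_left]
    intro r h h'
    simp only [S₂, S₃, A, Finset.mem_filter, Finset.mem_univ, true_and, Finset.mem_sdiff] at h h'
    obtain ⟨k, hk, -⟩ := h
    simpa [hk] using h'.1.1 k
  have h123 : Disjoint S₁ (S₂ ∪ S₃ \ S₄) := by
    rw [Finset.disjoint_left]
    intro r h h'
    simp only [S₁, S₂, S₃, A, Z, Finset.mem_filter, Finset.mem_univ, true_and, Finset.mem_sdiff,
      Finset.mem_union] at h h'
    rcases h' with ⟨k, hk, -⟩ | ⟨⟨-, k, hk⟩, -⟩ <;> simp [h k] at hk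
  have e₁ : ∑ r ∈ S₁, ∏ k, y (r k) = 1 := by
    rw [sum_words_forall_mem y {none} S₁ (by simp [S₁, NegativeWord])]
    simp [hy0]
  have e₂ := sum_words_single y {some 5} (some 2) (by decide) S₂ (by simp [S₂, RevealingWord])
  have e₃ := sum_words_exists_mem y A Z S₃ (by simp [S₃])
  have e₄ := sum_words_single y Z (some 1) (by decide) S₄ (by simp [S₄])
  have hA : ∑ l ∈ A, y l = X 0 + X 1 + X 3 + X 4 := by
    simp [A, hy]; ring
  have hAZ : ∑ l ∈ A \ Z, y l = X 1 + X 3 := by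
    have : A \ Z = {some 1, some 3} := by decide
    rw [this]; simp [hy]
  have hZ : ∑ l ∈ Z, y l = X 0 + X 4 := by simp [Z, hy]
  have e₅ := Finset.sum_sdiff (f := fun r => ∏ k, y (r k)) h43
  rw [hS, Finset.sum_union h123, Finset.sum_union h23, e₁, e₂, eq_sub_of_add_eq e₅, e₃, e₄, hA, hAZ,
    hZ]
  simp only [Finset.sum_singleton, hy]
  ring

open MvPolynomial in
theorem sum_itemWords (d : ℕ) :
    ∑ p ∈ itemWords d,
      monomial (statusExponent p.1 + ∑ k, itemLabelExponent (p.2 k)) (1 : ℚ) =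
    (tVar 0 * ((sVar 4 + sVar 5) ^ d - sVar 4 ^ d) + tVar 1 * sVar 0 ^ d + sVar 3 ^ d
      + (1 + sVar 1 + sVar 2) ^ d - (sVar 1 + sVar 2) ^ d) := by
  classical
  let y : EdgeLabel → MvPolynomial (Fin 2 ⊕ Fin 6) ℚ := fun l => monomial (itemLabelExponent l) 1
  have hy : ∀ k, y (some k) = sVar k := fun k => rfl
  have hy0 : y none = 1 := rfl
  have hz : ∀ s, monomial (statusExponent s) (1 : ℚ) =
    match s with | .detected => tVar 0 | .missed => tVar 1 | _ => 1 := by rintro (_ | _ | _ | _) <;> rfl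
  have hmul : ∀ p : ItemStatus × (Fin d → EdgeLabel),
      monomial (statusExponent p.1 + ∑ k, itemLabelExponent (p.2 k)) (1 : ℚ) =
        monomial (statusExponent p.1) (1 : ℚ) * ∏ k, y (p.2 k) := by
    intro p
    rw [← one_mul (1 : ℚ), ← monomial_mul, monomial_sum_one, one_mul]
  let S : ItemStatus → Finset (Fin d → EdgeLabel) := fun s => Finset.univ.filter (ItemValid s)
  have h : ∑ p ∈ itemWords d,
      monomial (statusExponent p.1 + ∑ k, itemLabelExponent (p.2 k)) (1 : ℚ) =
      ∑ s, monomial (statusExponent s) (1 : ℚ) * ∑ r ∈ S s, ∏ k, y (r k) := by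
    simp only [hmul, itemWords, S, Finset.sum_filter, Fintype.sum_prod_type, Finset.mul_sum, mul_ite,
      mul_zero]
  have e₁ := sum_words_exists_mem y {some 4, some 5} {some 5} (S .detected)
    (by simp [S, ItemValid])
  have e₂ := sum_words_forall_mem y {some 0} (S .missed) (by simp [S, ItemValid])
  have e₃ := sum_words_forall_mem y {some 3} (S .hidden) (by simp [S, ItemValid])
  have e₄ := sum_words_exists_mem y {none, some 1, some 2} {none} (S .cleared)
    (by simp [S, ItemValid])
  have h45 : ({some 4, some 5} : Finset EdgeLabel) \ {some 5} = {some 4} := by decide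
  have h12 : ({none, some 1, some 2} : Finset EdgeLabel) \ {none} = {some 1, some 2} := by decide
  have hu : (Finset.univ : Finset ItemStatus) = {.detected, .missed, .hidden, .cleared} := rfl
  rw [h, hu]
  simp only [Finset.mem_insert, Finset.mem_singleton, reduceCtorEq, or_self, not_false_eq_true,
    Finset.sum_insert, Finset.sum_singleton, hz, e₁, e₂, e₃, e₄, h45, h12, hy, hy0]
  have h54 : ¬(4 : Fin 6) = 5 := by decide
  have h21 : ¬(1 : Fin 6) = 2 := by decide
  simp only [h54, h21, not_false_eq_true, Finset.sum_insert, Finset.mem_singleton,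
    Option.some.injEq, Finset.sum_singleton, hy]
  ring

/-- Grouping nodes by degree turns the product over degrees into one factor per node. Degree 0 is
absent on the left, hence `h0`. -/
theorem prod_pow_card_fiber {ι M : Type*} [Fintype ι] [CommMonoid M] (deg : ι → ℕ) (D : ℕ)
    (hD : ∀ v, deg v ≤ D) (B : ℕ → M) (h0 : ∀ v, deg v = 0 → B 0 = 1) :
    ∏ d ∈ Finset.Icc 1 D, B d ^ (Finset.univ.filter fun v => deg v = d).card =
      ∏ v, B (deg v) := by
  have h : Finset.range (D + 1) = insert 0 (Finset.Icc 1 D) := by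
    ext d; simp; omega
  rw [← Finset.prod_fiberwise_of_maps_to (s := Finset.univ) (t := Finset.range (D + 1)) (g := deg)
    (fun v _ => Finset.mem_range.2 (Nat.lt_succ_of_le (hD v))), h, Finset.prod_insert (by simp)]
  rw [Finset.prod_eq_one (s := Finset.univ.filter _), one_mul]
  · refine Finset.prod_congr rfl fun d _ => ?_
    rw [← Finset.prod_const]
    refine Finset.prod_congr rfl fun v hv => ?_
    rw [(Finset.mem_filter.1 hv).2]
  · intro v hv
    have := (Finset.mem_filter.1 hv).2
    rw [this, h0 v this]

theorem sum_labelExponent_apply {m : ℕ} {b : Fin m → ℕ} (q : TestLabelling b) (l : Fin 6) :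
    (∑ c, ∑ k, labelExponent (q c k)) l = testLabelCount q (some l) := by
  have h : ∀ x : EdgeLabel, labelExponent x l = if x = some l then 1 else 0 := by
    rintro (_ | x) <;> simp [labelExponent, Finsupp.single_apply]
  simp only [Finsupp.finsetSum_apply, h, testLabelCount, Finset.card_filter, Fintype.sum_sigma]

theorem sum_itemExponent_apply_inr {n : ℕ} {a : Fin n → ℕ} (p : ItemLabelling a) (l : Fin 6) :
    (∑ v, (statusExponent (p v).1 + ∑ k, itemLabelExponent ((p v).2 k))) (Sum.inr l) =
      itemLabelCount p (some l) := by
  have h : ∀ x : EdgeLabel, itemLabelExponent x (Sum.inr l) = if x = some l then 1 else 0 := by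
    rintro (_ | x) <;> simp [itemLabelExponent, Finsupp.single_apply]
  have h' : ∀ s, statusExponent s (Sum.inr l) = 0 := by
    rintro (_ | _ | _ | _) <;> simp [statusExponent]
  simp only [Finsupp.finsetSum_apply, Finsupp.add_apply, h, h', zero_add, itemLabelCount,
    Finset.card_filter, Fintype.sum_sigma]

theorem sum_itemExponent_apply_inl {n : ℕ} {a : Fin n → ℕ} (p : ItemLabelling a) (l : Fin 2) :
    (∑ v, (statusExponent (p v).1 + ∑ k, itemLabelExponent ((p v).2 k))) (Sum.inl l) =
      statusCount p (![.detected, .missed] l) := by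
  have h : ∀ x : EdgeLabel, itemLabelExponent x (Sum.inl l) = 0 := by
    rintro (_ | x) <;> simp [itemLabelExponent]
  have h' : ∀ s, statusExponent s (Sum.inl l) = if s = ![.detected, .missed] l then 1 else 0 := by
    fin_cases l <;> rintro (_ | _ | _ | _) <;> simp [statusExponent]
  simp only [Finsupp.finsetSum_apply, Finsupp.add_apply, h, h', Finset.sum_const_zero, add_zero,
    statusCount, Finset.card_filter]

/-! ### Coefficients count valid labellings -/

section DegreeDistributions

variable {n m : ℕ} {G : PoolingGraph n m} {Λ P : ℚ[X]}

theorem gCoeff_eq (hn : 0 < n) (hG : G.HasDegreeDistributions Λ P) (x : Fin 6 → ℕ) :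
    gCoeff n m P (x 0) (x 1) (x 2) (x 3) (x 4) (x 5) =
      ((testLabellings G.rightDeg).filter fun q => ∀ l, testLabelCount q (some l) = x l).card := by
  have hfloor : ∀ d, ⌊(n : ℚ) * (((m : ℚ) / n) * P.coeff d)⌋₊ =
      (Finset.univ.filter fun c => G.rightDeg c = d).card := by
    intro d
    have hn' : (n : ℚ) ≠ 0 := by exact_mod_cast hn.ne'
    rcases Nat.eq_zero_or_pos m with rfl | hm
    · simp
    · have hm' : (m : ℚ) ≠ 0 := by exact_mod_cast hm.ne'
      rw [hG.2, ← mul_assoc, mul_div_cancel₀ _ hn', mul_div_cancel₀ _ hm', Nat.floor_natCast]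
  have hx : ![x 0, x 1, x 2, x 3, x 4, x 5] = x := by
    funext k; fin_cases k <;> rfl
  rw [gCoeff, gPow, hx]
  simp only [hfloor]
  -- Tests of degree 0 are allowed: the bracket of `g` at `d = 0` equals 1, for the empty negative
  -- word.
  rw [prod_pow_card_fiber G.rightDeg P.natDegree hG.rightDeg_le _ (by simp)]
  simp only [← sum_testWords]
  rw [coeff_prod_sum_monomial]
  simp only [Finsupp.ext_iff, sum_labelExponent_apply, testLabellings,
    Finsupp.equivFunOnFinite_symm_apply_apply]

theorem fCoeff_eq (hn : 0 < n) (hΛ : Λ.coeff 0 = 0) (hG : G.HasDegreeDistributions Λ P) (i j : ℕ)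
    (x : Fin 6 → ℕ) :
    fCoeff n Λ i j (x 0) (x 1) (x 2) (x 3) (x 4) (x 5) =
      ((itemLabellings G.leftDeg i j).filter fun p => ∀ l, itemLabelCount p (some l) = x l).card := by
  have hn' : (n : ℚ) ≠ 0 := by exact_mod_cast hn.ne'
  have hfloor : ∀ d, ⌊(n : ℚ) * Λ.coeff d⌋₊ =
      (Finset.univ.filter fun v => G.leftDeg v = d).card := by
    intro d
    rw [hG.1, mul_div_cancel₀ _ hn', Nat.floor_natCast]
  have hx : ![x 0, x 1, x 2, x 3, x 4, x 5] = x := by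
    funext k; fin_cases k <;> rfl
  -- Here `Λ₀ = 0` matters: the bracket of `f` at `d = 0` is `t₂ + 1`, not 1.
  have h0 : ∀ v, G.leftDeg v ≠ 0 := by
    intro v hv
    have h1 := hfloor 0
    rw [hΛ, mul_zero, Nat.floor_zero, eq_comm, Finset.card_eq_zero,
      Finset.filter_eq_empty_iff] at h1
    exact h1 (Finset.mem_univ v) hv
  rw [fCoeff, fPow, hx]
  simp only [hfloor]
  rw [prod_pow_card_fiber G.leftDeg Λ.natDegree hG.leftDeg_le _ fun v hv => absurd hv (h0 v)]
  simp only [← sum_itemWords]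
  rw [coeff_prod_sum_monomial]
  simp only [Finsupp.ext_iff, itemLabellings, Finset.filter_filter, Sum.forall,
    sum_itemExponent_apply_inl, sum_itemExponent_apply_inr,
    Finsupp.equivFunOnFinite_symm_apply_apply, Fin.forall_fin_two, Sum.elim_inl, Sum.elim_inr,
    Matrix.cons_val_zero, Matrix.cons_val_one]

end DegreeDistributions

/-! ### Label counts and the summation range -/

section SocketCounting

variable {n : ℕ} {a : Fin n → ℕ}

theorem card_nodes_le_card_sockets (A : Finset (Fin n)) (B : Finset (Σ v, Fin (a v)))
    (h : ∀ v ∈ A, ∃ k, (⟨v, k⟩ : Σ v, Fin (a v)) ∈ B) : A.card ≤ B.card := by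
  classical
  refine le_trans (Finset.card_le_card fun v hv => ?_) (Finset.card_image_le (s := B) (f := Sigma.fst))
  obtain ⟨k, hk⟩ := h v hv
  exact Finset.mem_image.2 ⟨_, hk, rfl⟩

theorem card_sockets_le (A : Finset (Fin n)) (B : Finset (Σ v, Fin (a v))) (D : ℕ)
    (hD : ∀ v, a v ≤ D) (h : ∀ e ∈ B, e.1 ∈ A) : B.card ≤ A.card * D := by
  have h1 : B ⊆ A.sigma fun _ => Finset.univ := fun e he => by simp [h e he]
  refine (Finset.card_le_card h1).trans ?_
  rw [Finset.card_sigma]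
  refine Finset.sum_le_card_nsmul _ _ _ fun v _ => ?_
  simpa using hD v

end SocketCounting

theorem card_filter_mem_eq_sum {X L : Type*} [Fintype X] [DecidableEq L] (f : X → L)
    (A : Finset L) :
    (Finset.univ.filter fun x => f x ∈ A).card =
      ∑ l ∈ A, (Finset.univ.filter fun x => f x = l).card := by
  simp only [Finset.card_filter]
  rw [Finset.sum_comm]
  simp

theorem sum_itemLabelCount {n : ℕ} {a : Fin n → ℕ} (p : ItemLabelling a) :
    ∑ l, itemLabelCount p l = ∑ v, a v := by
  have h := card_filter_mem_eq_sum (fun e : Σ v, Fin (a v) => (p e.1).2 e.2) Finset.univ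
  simpa [itemLabelCount] using h.symm

theorem sum_testLabelCount {m : ℕ} {b : Fin m → ℕ} (q : TestLabelling b) :
    ∑ l, testLabelCount q l = ∑ c, b c := by
  have h := card_filter_mem_eq_sum (fun e : Σ c, Fin (b c) => q e.1 e.2) Finset.univ
  simpa [testLabelCount] using h.symm

theorem sum_statusCount {n : ℕ} {a : Fin n → ℕ} (p : ItemLabelling a) :
    ∑ s, statusCount p s = n := by
  have h := card_filter_mem_eq_sum (fun v => (p v).1) Finset.univ
  simpa [statusCount] using h.symm

section

variable {n m : ℕ} {G : PoolingGraph n m} {Λ P : ℚ[X]}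

theorem numEdges_eq (hn : 0 < n) (hG : G.HasDegreeDistributions Λ P) :
    numEdges n Λ = ∑ v, G.leftDeg v := by
  have hn' : (n : ℚ) ≠ 0 := by exact_mod_cast hn.ne'
  have h : (n : ℚ) * (Λ.sum fun d c => (d : ℚ) * c) = ((∑ v, G.leftDeg v : ℕ) : ℚ) := by
    rw [Polynomial.sum_over_range _ (by simp), Finset.mul_sum, Nat.cast_sum,
      ← Finset.sum_fiberwise_of_maps_to (s := Finset.univ) (t := Finset.range (Λ.natDegree + 1))
        (g := G.leftDeg) (fun v _ => Finset.mem_range.2 (Nat.lt_succ_of_le (hG.leftDeg_le v)))]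
    refine Finset.sum_congr rfl fun d _ => ?_
    rw [Finset.sum_congr rfl (g := fun _ => (d : ℚ)), Finset.sum_const, hG.1]
    · rw [nsmul_eq_mul]; field_simp
    · intro v hv
      rw [(Finset.mem_filter.1 hv).2]
  rw [numEdges, h, Nat.floor_natCast]

/-- Each inequality compares nodes with sockets: a required letter costs a node at least one socket,
and a node has at most the maximal degree of them. -/
theorem ddAdmissible_of_labelCount_eq (hn : 0 < n) (hG : G.HasDegreeDistributions Λ P) {i j : ℕ}
    {p : ItemLabelling G.leftDeg} (hp : p ∈ itemLabellings G.leftDeg i j)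
    {q : TestLabelling G.rightDeg} (hq : q ∈ testLabellings G.rightDeg)
    (h : ∀ l, itemLabelCount p l = testLabelCount q l) :
    DDAdmissible n m Λ P i j (itemLabelCount p (some 0)) (itemLabelCount p (some 1))
      (itemLabelCount p (some 2)) (itemLabelCount p (some 3)) (itemLabelCount p (some 4))
      (itemLabelCount p (some 5)) := by
  classical
  obtain ⟨hv, hi, hj⟩ := mem_itemLabellings.1 hp
  rw [mem_testLabellings] at hq
  have hsum : ∑ s, statusCount p s = n := sum_statusCount p
  have hu : (Finset.univ : Finset ItemStatus) = {.detected, .missed, .hidden, .cleared} := rfl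
  rw [hu] at hsum
  simp only [Finset.mem_insert, Finset.mem_singleton, reduceCtorEq, or_self, not_false_eq_true,
    Finset.sum_insert, Finset.sum_singleton, hi, hj] at hsum
  have hlabels : ∑ l, itemLabelCount p l = numEdges n Λ := by
    rw [sum_itemLabelCount, numEdges_eq hn hG]
  rw [Fintype.sum_option] at hlabels
  simp only [Fin.sum_univ_six] at hlabels
  let N := Finset.univ.filter fun c => NegativeWord (q c)
  let D := Finset.univ.filter fun c => RevealingWord (q c)
  let O := Finset.univ.filter fun c => PositiveWord (q c)
  have hN : ∀ c, c ∈ N ↔ NegativeWord (q c) := by simp [N]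
  have hD : ∀ c, c ∈ D ↔ RevealingWord (q c) := by simp [D]
  have hO : ∀ c, c ∈ O ↔ PositiveWord (q c) := by simp [O]
  have hDO : Disjoint D O := by
    rw [Finset.disjoint_left]
    intro c h1 h2
    rw [hD] at h1
    rw [hO] at h2
    obtain ⟨k, hk, -⟩ := h1
    simpa [hk] using h2.1.1 k
  have hNDO : Disjoint N (D ∪ O) := by
    rw [Finset.disjoint_left]
    intro c h1 h2
    rw [hN] at h1
    rw [Finset.mem_union, hD, hO] at h2
    rcases h2 with ⟨k, hk, -⟩ | ⟨⟨-, k, hk⟩, -⟩ <;> simp [h1 k] at hk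
  have hm : N.card + (D.card + O.card) = m := by
    rw [← Finset.card_union_of_disjoint hDO, ← Finset.card_union_of_disjoint hNDO]
    have : N ∪ (D ∪ O) = Finset.univ := by
      ext c
      simpa [hN, hD, hO, TestValid] using hq c
    simp [this]
  -- A revealing word has just one `some 5`. Equality holds, but this direction suffices below.
  have hb₁ : itemLabelCount p (some 5) ≤ D.card := by
    rw [h]
    refine Finset.card_le_card_of_injOn Sigma.fst ?_ ?_
    · rintro ⟨c, k⟩ hk
      simp only [Finset.coe_filter, Finset.mem_univ, true_and, Set.mem_ofPred_eq] at hk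
      refine (hD c).2 ?_
      rcases hq c with h1 | h1 | h1
      · simp [h1 k] at hk
      · exact h1
      · simpa [hk] using h1.1.1 k
    · rintro ⟨c, k⟩ hk ⟨c', k'⟩ hk' (rfl : c = c')
      simp only [Finset.coe_filter, Finset.mem_univ, true_and, Set.mem_ofPred_eq] at hk hk'
      rcases hq c with h1 | ⟨k₀, -, h1⟩ | h1
      · simp [h1 k] at hk
      · have h2 : k = k₀ := by by_contra hne; simp [h1 k hne] at hk
        have h3 : k' = k₀ := by by_contra hne; simp [h1 k' hne] at hk'
        rw [h2, h3]
      · simpa [hk] using h1.1.1 k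
  have hl : itemLabelCount p (some 2) ≤ statusCount p .cleared * Λ.natDegree := by
    refine card_sockets_le _ _ _ hG.leftDeg_le ?_
    rintro ⟨v, k⟩ hk
    simp only [Finset.mem_filter, Finset.mem_univ, true_and] at hk ⊢
    have hval := hv v
    cases hs : (p v).1 <;> simp only [hs, ItemValid] at hval
    · simpa [hk] using hval.1 k
    · simpa [hk] using hval k
    · simpa [hk] using hval k
    · rfl
  have hpos : itemLabelCount p (some 0) + itemLabelCount p (some 1) + itemLabelCount p (some 3) +
      itemLabelCount p (some 4) ≤ O.card * P.natDegree := by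
    have h1 := card_filter_mem_eq_sum (fun e : Σ c, Fin (G.rightDeg c) => q e.1 e.2)
      {some 0, some 1, some 3, some 4}
    have h2 := card_sockets_le O (Finset.univ.filter fun e : Σ c, Fin (G.rightDeg c) =>
      q e.1 e.2 ∈ ({some 0, some 1, some 3, some 4} : Finset EdgeLabel)) _ hG.rightDeg_le (by
        rintro ⟨c, k⟩ hk
        simp only [Finset.mem_filter, Finset.mem_univ, true_and, Finset.mem_insert,
          Finset.mem_singleton] at hk
        rw [hO]
        rcases hq c with h1 | ⟨k₀, h2, h1⟩ | h1
        · simp [h1 k] at hk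
        · by_cases hkk : k = k₀
          · subst hkk; simp [h2] at hk
          · simp [h1 k hkk] at hk
        · exact h1)
    rw [h1] at h2
    simp only [h]
    simp [add_assoc] at h2 ⊢
    exact h2
  have hclr : statusCount p .cleared ≤ itemLabelCount p none := by
    refine card_nodes_le_card_sockets _ _ fun v hs => ?_
    simp only [Finset.mem_filter, Finset.mem_univ, true_and] at hs
    have hval := hv v
    rw [hs] at hval
    obtain ⟨-, k, hk⟩ := hval
    exact ⟨k, by simpa using hk⟩
  have hneg : testLabelCount q none ≤ N.card * P.natDegree := by
    refine card_sockets_le _ _ _ hG.rightDeg_le ?_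
    rintro ⟨c, k⟩ hk
    simp only [Finset.mem_filter, Finset.mem_univ, true_and] at hk
    rw [hN]
    rcases hq c with h1 | ⟨k₀, h2, h1⟩ | h1
    · exact h1
    · by_cases hkk : k = k₀
      · subst hkk; simp [h2] at hk
      · simp [h1 k hkk] at hk
    · simpa [hk] using h1.1.1 k
  have hdef : D.card + O.card ≤ itemLabelCount p (some 0) + itemLabelCount p (some 4) +
      itemLabelCount p (some 5) := by
    have h1 := card_filter_mem_eq_sum (fun e : Σ c, Fin (G.rightDeg c) => q e.1 e.2)
      {some 0, some 4, some 5}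
    have h2 := card_nodes_le_card_sockets (D ∪ O) (Finset.univ.filter
      fun e : Σ c, Fin (G.rightDeg c) =>
        q e.1 e.2 ∈ ({some 0, some 4, some 5} : Finset EdgeLabel)) (by
      intro c hc
      rw [Finset.mem_union, hD, hO] at hc
      rcases hc with ⟨k, hk, -⟩ | ⟨⟨-, k, hk⟩, -⟩
      · exact ⟨k, by simp [hk]⟩
      · exact ⟨k, by rcases hk with hk | hk <;> simp [hk]⟩)
    rw [h1, Finset.card_union_of_disjoint hDO] at h2
    simp only [h]
    simp [add_assoc] at h2 ⊢
    exact h2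
  have hdef' : itemLabelCount p (some 0) + itemLabelCount p (some 4) + itemLabelCount p (some 5) ≤
      (i + j) * Λ.natDegree := by
    have h1 := card_filter_mem_eq_sum (fun e : Σ v, Fin (G.leftDeg v) => (p e.1).2 e.2)
      {some 0, some 4, some 5}
    have h3 := card_filter_mem_eq_sum (fun v => (p v).1) {.detected, .missed}
    have h2 := card_sockets_le
      (Finset.univ.filter fun v => (p v).1 ∈ ({.detected, .missed} : Finset ItemStatus))
      (Finset.univ.filter fun e : Σ v, Fin (G.leftDeg v) =>
        (p e.1).2 e.2 ∈ ({some 0, some 4, some 5} : Finset EdgeLabel)) _ hG.leftDeg_le (by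
      rintro ⟨v, k⟩ hk
      simp only [Finset.mem_filter, Finset.mem_univ, true_and, Finset.mem_insert,
          Finset.mem_singleton] at hk ⊢
      have hval := hv v
      cases hs : (p v).1 <;> simp only [hs, ItemValid] at hval
      · simp
      · simp
      · simp [hval k] at hk
      · rcases hval.1 k with h | h | h <;> simp [h] at hk)
    rw [h1, h3, Finset.sum_pair (by simp)] at h2
    rw [← hi, ← hj]
    simp [add_assoc] at h2 ⊢
    exact h2
  have hi₁ : i ≤ itemLabelCount p (some 5) := by
    rw [← hi]
    refine card_nodes_le_card_sockets _ _ fun v hs => ?_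
    simp only [Finset.mem_filter, Finset.mem_univ, true_and] at hs
    have hval := hv v
    rw [hs] at hval
    obtain ⟨-, k, hk⟩ := hval
    exact ⟨k, by simpa using hk⟩
  have hi₂ : itemLabelCount p (some 5) ≤ i * Λ.natDegree := by
    rw [← hi]
    refine card_sockets_le _ _ _ hG.leftDeg_le ?_
    rintro ⟨v, k⟩ hk
    simp only [Finset.mem_filter, Finset.mem_univ, true_and] at hk ⊢
    have hval := hv v
    cases hs : (p v).1 <;> simp only [hs, ItemValid] at hval
    · rfl
    · simpa [hk] using hval k
    · simpa [hk] using hval k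
    · simpa [hk] using hval.1 k
  have hcl : statusCount p .cleared = n - i - j - statusCount p .hidden := by omega
  -- The witnesses are `k`, the number of hidden items, and `b₂`, the number of tests with positive
  -- words.
  refine ⟨by omega, statusCount p .hidden, O.card, by omega, by omega, hcl ▸ hl, hpos, ?_, by omega,
    hi₁, hi₂⟩
  rw [← hcl]
  refine (hclr.trans ((h none).le.trans hneg)).trans (Nat.mul_le_mul_right _ ?_)
  omega

/-! ### Averaging over connections and degree sequences -/

/-- For fixed degrees, the numerators of the average summed over all connections. -/
theorem sum_ddPatternCount (hn : 0 < n) (hΛ : Λ.coeff 0 = 0) (hG : G.HasDegreeDistributions Λ P)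
    (i j : ℕ) :
    ∑ π : (Σ v, Fin (G.leftDeg v)) ≃ (Σ c, Fin (G.rightDeg c)),
        ((⟨G.leftDeg, G.rightDeg, π⟩ : PoolingGraph n m).ddPatternCount (i + j) j : ℚ) =
      (Fintype.card ((Σ v, Fin (G.leftDeg v)) ≃ (Σ c, Fin (G.rightDeg c))) : ℚ) *
      ∑ a ∈ ddRange n m Λ P i j,
        gCoeff n m P (a 0) (a 1) (a 2) (a 3) (a 4) (a 5) *
          fCoeff n Λ i j (a 0) (a 1) (a 2) (a 3) (a 4) (a 5) /
          (multinomialSeven (numEdges n Λ) (a 0) (a 1) (a 2) (a 3) (a 4) (a 5) : ℚ) := by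
  classical
  have hN := numEdges_eq hn hG
  have hE : Fintype.card (Σ v, Fin (G.leftDeg v)) = numEdges n Λ := by simp [hN]
  have hcard : Fintype.card ((Σ v, Fin (G.leftDeg v)) ≃ (Σ c, Fin (G.rightDeg c))) =
      (numEdges n Λ).factorial := by
    rw [Fintype.card_equiv G.conn, hE]
  have hNr : ∑ c, G.rightDeg c = numEdges n Λ := by
    have := Fintype.card_congr G.conn
    simpa [hN] using this.symm
  set N := numEdges n Λ
  -- The number of bijections matching two labellings with common counts `x`; the first factorial is
  -- for the label `none`.
  let W : (Fin 6 → ℕ) → ℚ := fun x => ((N - ∑ l, x l).factorial * ∏ l, (x l).factorial : ℕ)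
  have hW : ∀ x ∈ ddRange n m Λ P i j, (N.factorial : ℚ) /
      (multinomialSeven N (x 0) (x 1) (x 2) (x 3) (x 4) (x 5) : ℚ) = W x := by
    intro x hx
    have hle : x 0 + x 1 + x 2 + x 3 + x 4 + x 5 ≤ N := (Finset.mem_filter.1 hx).2.1
    have hs := Nat.multinomial_spec Finset.univ
      ![x 0, x 1, x 2, x 3, x 4, x 5, N - x 0 - x 1 - x 2 - x 3 - x 4 - x 5]
    simp only [Fin.sum_univ_seven, Fin.prod_univ_seven] at hs
    have hpos : (multinomialSeven N (x 0) (x 1) (x 2) (x 3) (x 4) (x 5) : ℚ) ≠ 0 := by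
      exact_mod_cast (Nat.multinomial_pos _ _).ne'
    rw [div_eq_iff hpos]
    simp only [W, Fin.sum_univ_six, Fin.prod_univ_six, multinomialSeven]
    norm_cast
    have h1 : N - (x 0 + x 1 + x 2 + x 3 + x 4 + x 5) =
      N - x 0 - x 1 - x 2 - x 3 - x 4 - x 5 := by omega
    have h2 : x 0 + x 1 + x 2 + x 3 + x 4 + x 5 + (N - x 0 - x 1 - x 2 - x 3 - x 4 - x 5) = N := by
      omega
    rw [h1]
    change (x 0).factorial * (x 1).factorial * (x 2).factorial * (x 3).factorial *
      (x 4).factorial * (x 5).factorial * (N - x 0 - x 1 - x 2 - x 3 - x 4 - x 5).factorial * _ =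
      (x 0 + x 1 + x 2 + x 3 + x 4 + x 5 +
        (N - x 0 - x 1 - x 2 - x 3 - x 4 - x 5)).factorial at hs
    rw [h2] at hs
    rw [← hs]
    ring
  let LI := itemLabellings G.leftDeg i j
  let LT := testLabellings G.rightDeg
  let cI : ItemLabelling G.leftDeg → Fin 6 → ℕ := fun p l => itemLabelCount p (some l)
  let cT : TestLabelling G.rightDeg → Fin 6 → ℕ := fun q l => testLabelCount q (some l)
  have hcI : ∀ p : ItemLabelling G.leftDeg, itemLabelCount p none = N - ∑ l, cI p l := by
    intro p
    have := sum_itemLabelCount p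
    rw [Fintype.sum_option, ← hN] at this
    simp only [cI]
    omega
  have hcT : ∀ q : TestLabelling G.rightDeg, testLabelCount q none = N - ∑ l, cT q l := by
    intro q
    have := sum_testLabelCount q
    rw [Fintype.sum_option, hNr] at this
    simp only [cT]
    omega
  have hagree : ∀ p q, (∀ l, itemLabelCount p l = testLabelCount q l) ↔ cI p = cT q := by
    intro p q
    constructor
    · exact fun h => funext fun l => h (some l)
    -- Both sides have `N` sockets, so the six recorded counts fix that of `none`.
    · rintro h (_ | l)
      · rw [hcI, hcT, h]
      · exact congrFun h l
  have hmatch : ∀ (p : ItemLabelling G.leftDeg) (q : TestLabelling G.rightDeg),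
      ((Finset.univ.filter fun π : (Σ v, Fin (G.leftDeg v)) ≃ (Σ c, Fin (G.rightDeg c)) =>
        ∀ e, q (π e).1 (π e).2 = (p e.1).2 e.2).card : ℚ) = if cI p = cT q then W (cI p) else 0 := by
    intro p q
    have h := card_equiv_of_comp_eq (fun e : Σ v, Fin (G.leftDeg v) => (p e.1).2 e.2)
      (fun y : Σ c, Fin (G.rightDeg c) => q y.1 y.2)
    change _ = (if ∀ l, itemLabelCount p l = testLabelCount q l then
      ∏ l, (itemLabelCount p l).factorial else 0) at h
    rw [h]
    simp only [hagree, W, Fintype.prod_option, hcI, cI]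
    split_ifs <;> simp
  have hmem : ∀ p ∈ LI, ∀ q ∈ LT, cI p = cT q → cI p ∈ ddRange n m Λ P i j := by
    intro p hp q hq h
    have hadm := ddAdmissible_of_labelCount_eq hn hG hp hq ((hagree p q).2 h)
    refine Finset.mem_filter.2 ⟨?_, hadm⟩
    rw [Fintype.mem_piFinset]
    intro l
    rw [Finset.mem_range, Nat.lt_succ_iff]
    refine (Finset.single_le_sum (f := cI p) (fun _ _ => Nat.zero_le _) (Finset.mem_univ l)).trans ?_
    rw [Fin.sum_univ_six]
    exact hadm.1
  have hcount : ∀ π : (Σ v, Fin (G.leftDeg v)) ≃ (Σ c, Fin (G.rightDeg c)),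
      (⟨G.leftDeg, G.rightDeg, π⟩ : PoolingGraph n m).ddPatternCount (i + j) j =
        ((LI ×ˢ LT).filter fun x => ∀ e, x.2 (π e).1 (π e).2 = (x.1 e.1).2 e.2).card :=
    fun π => PoolingGraph.ddPatternCount_eq ⟨G.leftDeg, G.rightDeg, π⟩ i j
  calc _ = ∑ x ∈ LI ×ˢ LT,
        ((Finset.univ.filter fun π : (Σ v, Fin (G.leftDeg v)) ≃ (Σ c, Fin (G.rightDeg c)) =>
          ∀ e, x.2 (π e).1 (π e).2 = (x.1 e.1).2 e.2).card : ℚ) := by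
        simp only [hcount, Finset.card_filter, Nat.cast_sum]
        rw [Finset.sum_comm]
    _ = ∑ p ∈ LI, ∑ q ∈ LT, if cI p = cT q then W (cI p) else 0 := by
        rw [Finset.sum_product]
        simp only [hmatch]
    _ = ∑ p ∈ LI, ∑ q ∈ LT, ∑ x ∈ ddRange n m Λ P i j,
          (if cT q = x then 1 else 0) * (if cI p = x then 1 else 0) * W x := by
        refine Finset.sum_congr rfl fun p hp => Finset.sum_congr rfl fun q hq => ?_
        split_ifs with h
        · rw [Finset.sum_eq_single_of_mem (cI p) (hmem p hp q hq h)]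
          · simp [h]
          · intro x _ hx
            simp [hx.symm]
        · symm
          refine Finset.sum_eq_zero fun x _ => ?_
          by_cases h1 : cI p = x
          · have h2 : ¬cT q = x := fun h2 => h (h1.trans h2.symm)
            simp [h2]
          · simp [h1]
    _ = ∑ x ∈ ddRange n m Λ P i j, ((LT.filter fun q => cT q = x).card : ℚ) *
          ((LI.filter fun p => cI p = x).card : ℚ) * W x := by
        rw [Finset.sum_congr rfl fun p _ => Finset.sum_comm, Finset.sum_comm]
        simp only [Finset.card_filter, Nat.cast_sum, Finset.sum_mul]
        refine Finset.sum_congr rfl fun x _ => ?_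
        rw [Finset.sum_comm]
        refine Finset.sum_congr rfl fun q _ => ?_
        rw [Finset.mul_sum, Finset.sum_mul]
        simp
    _ = _ := by
        rw [Finset.mul_sum, hcard]
        refine Finset.sum_congr rfl fun x hx => ?_
        rw [gCoeff_eq hn hG, fCoeff_eq hn hΛ hG, ← hW x hx]
        simp only [cI, cT, funext_iff]
        ring

end

/-- The ensemble splits by degree sequences, and each fibre is the set of all connections. The right
side depends only on the distributions, so the average over every fibre is the same. -/
theorem lemma4 (n m : ℕ) (hn : 0 < n) (Λ P : ℚ[X]) (hΛ : Λ.coeff 0 = 0)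
    (hne : Nonempty (PoolingEnsemble n m Λ P)) (i j : ℕ) :
    avgEnumeratorDD n m Λ P (i + j) j =
      ∑ a ∈ ddRange n m Λ P i j,
        gCoeff n m P (a 0) (a 1) (a 2) (a 3) (a 4) (a 5) *
          fCoeff n Λ i j (a 0) (a 1) (a 2) (a 3) (a 4) (a 5) /
          (multinomialSeven (numEdges n Λ) (a 0) (a 1) (a 2) (a 3) (a 4) (a 5) : ℚ) := by
  classical
  have hcard : (Fintype.card (PoolingEnsemble n m Λ P) : ℚ) ≠ 0 := by
    exact_mod_cast Fintype.card_ne_zero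
  rw [avgEnumeratorDD, div_eq_iff hcard, mul_comm, ← nsmul_eq_mul, ← Finset.card_univ,
    ← Finset.sum_const]
  let deg : PoolingEnsemble n m Λ P → (Fin n → ℕ) × (Fin m → ℕ) := fun G =>
    (G.1.leftDeg, G.1.rightDeg)
  rw [← Finset.sum_fiberwise_of_maps_to (g := deg)
      (fun G _ => Finset.mem_image_of_mem deg (Finset.mem_univ G)),
    ← Finset.sum_fiberwise_of_maps_to (g := deg)
      (fun G _ => Finset.mem_image_of_mem deg (Finset.mem_univ G))]
  refine Finset.sum_congr rfl fun d hd => ?_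
  obtain ⟨G, -, rfl⟩ := Finset.mem_image.1 hd
  have key : ∀ F : PoolingGraph n m → ℚ,
      ∑ H ∈ Finset.univ.filter (fun H => deg H = deg G), F H.1 =
        ∑ π : (Σ v, Fin (G.1.leftDeg v)) ≃ (Σ c, Fin (G.1.rightDeg c)),
          F ⟨G.1.leftDeg, G.1.rightDeg, π⟩ := by
    intro F
    symm
    refine Finset.sum_bij (fun π _ => ⟨⟨G.1.leftDeg, G.1.rightDeg, π⟩, G.2⟩) ?_ ?_ ?_ ?_
    · intro π _
      simp [deg]
    · intro π _ π' _ h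
      exact eq_of_heq (PoolingGraph.mk.inj (congrArg Subtype.val h)).2.2
    · rintro ⟨⟨a, b, π⟩, hH⟩ h
      obtain ⟨rfl, rfl⟩ : a = G.1.leftDeg ∧ b = G.1.rightDeg := by simpa [deg] using h
      exact ⟨π, Finset.mem_univ _, rfl⟩
    · intro π _
      rfl
  rw [key fun H => (H.ddPatternCount (i + j) j : ℚ), sum_ddPatternCount hn hΛ G.2,
    key fun _ => _, Finset.sum_const, Finset.card_univ, nsmul_eq_mul]
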